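/- Let $N\ge 3$ be an integer. Let $f$ be of class $C^{1,\alpha}$ on $[0,\infty)$ for some $\alpha\in(0,1)$ (that is, $f\in C^1([0,\infty))$ and $f'$ is $\alpha$-Hölder continuous on every bounded interval $[0,R]$), positive on $(0,\infty)$, and such that $\int_u^\infty \frac{d\eta}{f(\eta)}<\infty$ for all $u>0$. Assume (A2): $f_0\in C^1([0,\infty))$ is a function such that $$f_0(u)>0,\quad F_0(u):=\int_u^\infty\frac{d\eta}{f_0(\eta)}<\infty\ \text{ for } u>0,\qquad \text{the limit } q:=\lim_{u\to\infty}f_0'(u)F_0(u)\in\mathbb{R}\text{ exists},\qquad \lim_{u\to\infty}\frac{f(u)}{f_0(u)}=1.$$ Assume moreover that $q<q_{\mathrm S}:=\frac{N+2}{4}$. Let $F_0^{-1}$ denote the inverse of the strictly decreasing function $F_0:(0,\infty)\to F_0((0,\infty))$. Then there are $r_0>0$ and a positive solution $U^*\in C^2(0,r_0)$ of $$U''(r)+\frac{N-1}{r}U'(r)+f(U(r))=0,\qquad 0<r<r_0,$$ which is singular at the origin, i.e. $U^*(r)\to\infty$ as $r\to 0^+$, and which is of the form $$U^*(r)=F_0^{-1}\bigl((2N-4q)^{-1}r^2(1+\theta(r))\bigr),\qquad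 0<r<r_0,$$ where $\theta\in C^2(0,r_0)$ satisfies $\theta(r)\to0$ as $r\to0^+$ (in particular, the argument of $F_0^{-1}$ lies in $F_0((0,\infty))$ for all $r\in(0,r_0)$). -/

import Mathlib

open Filter Topology Set MeasureTheory
open scoped NNReal

namespace RadialSingular

/-- The tail integral `u ↦ ∫_u^∞ dη / g(η)`.  It is written `F` when `g = f` and `F₀` when
`g = f₀`. -/
noncomputable def tailIntegral (g : ℝ → ℝ) (u : ℝ) : ℝ :=
  ∫ η in Ioi u, 1 / g η

/-- The integral `∫_u^∞ dη / g(η)` is finite for every `u > 0`. -/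
def TailFinite (g : ℝ → ℝ) : Prop :=
  ∀ u : ℝ, 0 < u → IntegrableOn (fun η => 1 / g η) (Ioi u) volume

/-- The inverse of the strictly decreasing function `u ↦ ∫_u^∞ dη / g(η)` on `(0, ∞)`. It is
meaningful on the image of `(0, ∞)` only. -/
noncomputable def tailInverse (g : ℝ → ℝ) : ℝ → ℝ :=
  Function.invFunOn (tailIntegral g) (Ioi 0)

/-- `f` is of class `C^{1,α}` on `[0, ∞)`: it is `C¹` (one-sided at `0`), and its derivative is
`α`-Hölder continuous on every bounded interval `[0, R]`. -/
def IsC1Holder (α : ℝ≥0) (f : ℝ → ℝ) : Prop :=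
  ContDiffOn ℝ 1 f (Ici 0) ∧
    ∀ R : ℝ, 0 < R → ∃ C : ℝ≥0, HolderOnWith C α (derivWithin f (Ici 0)) (Icc 0 R)

/-- The standing assumptions on the nonlinear term `f`; only its values on `[0, ∞)` matter. -/
structure IsNonlinearTerm (f : ℝ → ℝ) : Prop where
  regular : ∃ α : ℝ≥0, 0 < α ∧ α < 1 ∧ IsC1Holder α f
  pos : ∀ u : ℝ, 0 < u → 0 < f u
  superlinear : TailFinite f

/-- Assumption (A2) on `f`, with the comparison function `f₀` and the limit `q`. -/
structure AssumptionA2 (f f₀ : ℝ → ℝ) (q : ℝ) : Prop where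
  contDiffOn : ContDiffOn ℝ 1 f₀ (Ici 0)
  pos : ∀ u : ℝ, 0 < u → 0 < f₀ u
  tailFinite : TailFinite f₀
  tendsto_q : Tendsto (fun u => deriv f₀ u * tailIntegral f₀ u) atTop (𝓝 q)
  tendsto_ratio : Tendsto (fun u => f u / f₀ u) atTop (𝓝 1)

/-- The exponent `q_S`, the Hölder conjugate of the Sobolev exponent in dimension `N`. -/
noncomputable def qS (N : ℕ) : ℝ :=
  if N ≤ 2 then 1 else ((N : ℝ) + 2) / 4

/-- `U` is a positive classical solution, of class `C²`, of
`U'' + (N - 1) / r * U' + f(U) = 0` on the interval `(0, r₀)`. -/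
structure IsRadialSolution (N : ℕ) (f : ℝ → ℝ) (r₀ : ℝ) (U : ℝ → ℝ) : Prop where
  contDiffOn : ContDiffOn ℝ 2 U (Ioo 0 r₀)
  pos : ∀ r ∈ Ioo 0 r₀, 0 < U r
  equation : ∀ r ∈ Ioo 0 r₀,
    deriv (deriv U) r + ((N : ℝ) - 1) / r * deriv U r + f (U r) = 0

/-- `U` is singular at the origin: `U(r) → ∞` as `r → 0+`. -/
def SingularAtOrigin (U : ℝ → ℝ) : Prop :=
  Tendsto U (𝓝[>] 0) atTop

end RadialSingular

/-! Write `t = log r`, `P = dU/dt`, `Z = 2N - 4q`, let `F₀` be the tail integral of `f₀`, and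
measure the deviation from the expected profile by `w = 2t - log (Z F₀(U))` and `η = -P / (f₀(U)
F₀(U)) - 2`. Then `w' = -η`, and `η'` depends on `f` and `f₀` only through `η`, `w`, `ρ = f/f₀ → 1`
and `Q = f₀' F₀ → q`. For the limit values `ρ = 1`, `Q = q` the origin is an equilibrium with linear
part `η' = Z w - a η`, `w' = -η`, where `a = N + 2 - 4q`. The condition `q < q_S` says exactly that
the friction `a` is positive, and it also gives `Z > 0`; so the origin attracts forward in time and
has a strict quadratic Lyapunov function, robust under small errors in `ρ` and `Q`
(`exists_lyapunov`).

The singular solution is an ancient trajectory, defined for `t → -∞`. Trajectories started at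
equilibrium at times `t₀ - k` stay in an energy sublevel up to `t₀` (`exists_trapped_solution`);
compactness at `t₀` and backward Gronwall give a limit on `(-∞, t₀)` (`exists_ancient_solution`).
Its energy is bounded, but backward in time it would grow at a definite rate wherever it is not
small, so it tends to `0` as `t → -∞` (`eventually_le_of_deriv_le`). Hence `w → 0`, and `θ = e^{-w}
- 1` is the required correction. -/

namespace RadialSingular

/-! ### The tail integral and its inverse -/

section TailIntegral

variable {g : ℝ → ℝ}

theorem contDiffAt_of_contDiffOn_Ici (hg : ContDiffOn ℝ 1 g (Ici 0)) {u : ℝ} (hu : 0 < u) :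
    ContDiffAt ℝ 1 g u :=
  hg.contDiffAt (Ici_mem_nhds hu)

theorem hasDerivAt_of_contDiffOn_Ici (hg : ContDiffOn ℝ 1 g (Ici 0)) {u : ℝ} (hu : 0 < u) :
    HasDerivAt g (deriv g u) u :=
  ((contDiffAt_of_contDiffOn_Ici hg hu).differentiableAt one_ne_zero).hasDerivAt

theorem hasDerivAt_tailIntegral (hg : ContDiffOn ℝ 1 g (Ici 0)) (hpos : ∀ u, 0 < u → 0 < g u)
    (hfin : TailFinite g) {u : ℝ} (hu : 0 < u) :
    HasDerivAt (tailIntegral g) (-(1 / g u)) u := by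
  have hcont : ContinuousOn (fun η => 1 / g η) (Ioi 0) :=
    continuousOn_const.div (hg.continuousOn.mono Ioi_subset_Ici_self) fun x hx => (hpos x hx).ne'
  have hint : IntervalIntegrable (fun η => 1 / g η) volume u u := IntervalIntegrable.refl
  have h : HasDerivAt (fun x => ∫ η in u..x, 1 / g η) (1 / g u) u :=
    intervalIntegral.integral_hasDerivAt_right hint
      (hcont.stronglyMeasurableAtFilter isOpen_Ioi u hu) (hcont.continuousAt (Ioi_mem_nhds hu))
  refine (h.const_sub (tailIntegral g u)).congr_of_eventuallyEq ?_
  filter_upwards [Ioi_mem_nhds hu] with x hx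
  have := intervalIntegral.integral_Ioi_sub_Ioi' (hfin u hu) (hfin x hx)
  unfold tailIntegral
  linarith

theorem continuousOn_tailIntegral (hg : ContDiffOn ℝ 1 g (Ici 0))
    (hpos : ∀ u, 0 < u → 0 < g u) (hfin : TailFinite g) :
    ContinuousOn (tailIntegral g) (Ioi 0) := fun _ hu =>
  (hasDerivAt_tailIntegral hg hpos hfin hu).continuousAt.continuousWithinAt

theorem strictAntiOn_tailIntegral (hg : ContDiffOn ℝ 1 g (Ici 0))
    (hpos : ∀ u, 0 < u → 0 < g u) (hfin : TailFinite g) :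
    StrictAntiOn (tailIntegral g) (Ioi 0) := by
  refine strictAntiOn_of_deriv_neg (convex_Ioi 0) (continuousOn_tailIntegral hg hpos hfin) ?_
  intro u hu
  rw [interior_Ioi] at hu
  rw [(hasDerivAt_tailIntegral hg hpos hfin hu).deriv]
  have := hpos u hu
  simp [this]

theorem tailIntegral_pos (hg : ContDiffOn ℝ 1 g (Ici 0)) (hpos : ∀ u, 0 < u → 0 < g u)
    (hfin : TailFinite g) {u : ℝ} (hu : 0 < u) : 0 < tailIntegral g u := by
  have hu' : 0 < u + 1 := by linarith
  refine lt_of_le_of_lt ?_ (strictAntiOn_tailIntegral hg hpos hfin hu hu' (lt_add_one u))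
  refine setIntegral_nonneg measurableSet_Ioi fun x hx => ?_
  exact (one_div_pos.2 (hpos x (hu'.trans hx))).le

theorem tendsto_tailIntegral_atTop : Tendsto (tailIntegral g) atTop (𝓝 0) :=
  tendsto_integral_Ioi_zero tendsto_id

theorem contDiffOn_tailIntegral (hg : ContDiffOn ℝ 1 g (Ici 0))
    (hpos : ∀ u, 0 < u → 0 < g u) (hfin : TailFinite g) :
    ContDiffOn ℝ 2 (tailIntegral g) (Ioi 0) := by
  rw [show (2 : WithTop ℕ∞) = 1 + 1 from by norm_num,
    contDiffOn_succ_iff_deriv_of_isOpen isOpen_Ioi]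
  refine ⟨fun u hu =>
    (hasDerivAt_tailIntegral hg hpos hfin hu).differentiableAt.differentiableWithinAt,
    by simp, ?_⟩
  refine ContDiffOn.congr (f := fun u => -(1 / g u)) ?_ fun u hu =>
    (hasDerivAt_tailIntegral hg hpos hfin hu).deriv
  exact (contDiffOn_const.div (hg.mono Ioi_subset_Ici_self) fun x hx => (hpos x hx).ne').neg

theorem tailInverse_tailIntegral (hg : ContDiffOn ℝ 1 g (Ici 0))
    (hpos : ∀ u, 0 < u → 0 < g u) (hfin : TailFinite g) {u : ℝ} (hu : 0 < u) :
    tailInverse g (tailIntegral g u) = u :=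
  (strictAntiOn_tailIntegral hg hpos hfin).injOn.leftInvOn_invFunOn hu

end TailIntegral

/-! ### Solutions on compact intervals and ancient limits -/

section ODE

variable {E : Type*} [NormedAddCommGroup E] [NormedSpace ℝ E]

/-- A bounded vector field, Lipschitz in space and continuous in time, has global solutions. -/
theorem exists_solution_of_bounded_lipschitz [CompleteSpace E] {v : ℝ → E → E} {a b : ℝ}
    (hab : a ≤ b) {K L : ℝ≥0} (hK : ∀ t ∈ Icc a b, LipschitzWith K (v t))
    (hc : ∀ x, ContinuousOn (v · x) (Icc a b)) (hL : ∀ t ∈ Icc a b, ∀ x, ‖v t x‖ ≤ L) (x₀ : E) :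
    ∃ x : ℝ → E, x a = x₀ ∧ ∀ t ∈ Icc a b, HasDerivWithinAt x (v t (x t)) (Icc a b) t := by
  -- Speed at most `L` keeps the solution within `L (b - a)` of `x₀`, so a ball of that radius never
  -- stops it.
  have h : IsPicardLindelof v (⟨a, left_mem_Icc.2 hab⟩ : Icc a b) x₀
      (L * (b - a).toNNReal) 0 L K :=
    { lipschitzOnWith := fun t ht => (hK t ht).lipschitzOnWith
      continuousOn := fun x _ => hc x
      norm_le := fun t ht x _ => hL t ht x
      mul_max_le := by
        have : (0 : ℝ) ≤ b - a := sub_nonneg.2 hab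
        simp [this] }
  exact h.exists_eq_forall_mem_Icc_hasDerivWithinAt₀

/-- Backward Gronwall estimate. -/
theorem dist_le_of_trajectories_backward {v : ℝ → E → E} {D : ℝ → Set E} {K : ℝ≥0} {a b : ℝ}
    {x y : ℝ → E} (hv : ∀ t ∈ Icc a b, LipschitzOnWith K (v t) (D t))
    (hx : ∀ t ∈ Icc a b, HasDerivWithinAt x (v t (x t)) (Icc a b) t)
    (hxD : ∀ t ∈ Icc a b, x t ∈ D t)
    (hy : ∀ t ∈ Icc a b, HasDerivWithinAt y (v t (y t)) (Icc a b) t)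
    (hyD : ∀ t ∈ Icc a b, y t ∈ D t) :
    ∀ t ∈ Icc a b, dist (x t) (y t) ≤ dist (x b) (y b) * Real.exp (K * (b - t)) := by
  have hmem : ∀ τ ∈ Icc (-b) (-a), -τ ∈ Icc a b := fun τ hτ =>
    ⟨by linarith [hτ.2], by linarith [hτ.1]⟩
  have hmaps : MapsTo (fun τ : ℝ => -τ) (Icc (-b) (-a)) (Icc a b) := hmem
  have key : ∀ z : ℝ → E, (∀ t ∈ Icc a b, HasDerivWithinAt z (v t (z t)) (Icc a b) t) →
      ContinuousOn (fun τ => z (-τ)) (Icc (-b) (-a)) ∧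
      ∀ τ ∈ Ico (-b) (-a), HasDerivWithinAt (fun τ => z (-τ)) (-(v (-τ) (z (-τ)))) (Ici τ) τ := by
    intro z hz
    have h : ∀ τ ∈ Icc (-b) (-a),
        HasDerivWithinAt (fun τ => z (-τ)) (-(v (-τ) (z (-τ)))) (Icc (-b) (-a)) τ := by
      intro τ hτ
      have := (hz (-τ) (hmem τ hτ)).scomp τ (hasDerivAt_neg τ).hasDerivWithinAt hmaps
      simpa [Function.comp_def] using this
    refine ⟨fun τ hτ => (h τ hτ).continuousWithinAt, fun τ hτ => ?_⟩
    refine (h τ ⟨hτ.1, hτ.2.le⟩).mono_of_mem_nhdsWithin ?_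
    exact mem_of_superset (Icc_mem_nhdsGE hτ.2) (Icc_subset_Icc_left hτ.1)
  intro t ht
  have := dist_le_of_trajectories_ODE_of_mem (v := fun τ z => -(v (-τ) z)) (s := fun τ => D (-τ))
    (K := K) (a := -b) (b := -a) (δ := dist (x b) (y b))
    (fun τ hτ => (hv (-τ) (hmem τ ⟨hτ.1, hτ.2.le⟩)).neg)
    (key x hx).1 (key x hx).2 (fun τ hτ => hxD _ (hmem τ ⟨hτ.1, hτ.2.le⟩))
    (key y hy).1 (key y hy).2 (fun τ hτ => hyD _ (hmem τ ⟨hτ.1, hτ.2.le⟩))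
    (by simp) (-t) ⟨by linarith [ht.2], by linarith [ht.1]⟩
  have e : -t - -b = b - t := by ring
  simpa [e] using this

/-- If for each `n` there is a solution on `[t₀ - n, t₀]` that stays in `D`, there is a solution
on `(-∞, t₀)` that stays in `D`. -/
theorem exists_ancient_solution [CompleteSpace E] {v : ℝ → E → E} {D : ℝ → Set E} {t₀ : ℝ}
    (hD : ∀ t, IsClosed (D t)) (hD₀ : IsCompact (D t₀))
    (hv : ∀ s, ∃ K : ℝ≥0, ∀ t ∈ Icc s t₀, LipschitzOnWith K (v t) (D t))
    (hex : ∀ n : ℕ, ∃ x : ℝ → E, ∀ t ∈ Icc (t₀ - n) t₀,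
      HasDerivWithinAt x (v t (x t)) (Icc (t₀ - n) t₀) t ∧ x t ∈ D t) :
    ∃ x : ℝ → E, ∀ t < t₀, HasDerivAt x (v t (x t)) t ∧ x t ∈ D t := by
  choose X hX using hex
  have hstart : ∀ n : ℕ, X n t₀ ∈ D t₀ := fun n =>
    (hX n t₀ ⟨by simp, le_rfl⟩).2
  -- Only the endpoint values at `t₀` need a convergent subsequence: backward Gronwall carries the
  -- Cauchy property to every `[s, t₀]`.
  obtain ⟨x₀, -, φ, hφ, hlim⟩ := hD₀.tendsto_subseq hstart
  have hev : ∀ s : ℝ, ∀ᶠ k in atTop, t₀ - (φ k : ℝ) ≤ s := by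
    intro s
    filter_upwards [hφ.tendsto_atTop.eventually (eventually_ge_atTop ⌈t₀ - s⌉₊)] with k hk
    have := (Nat.le_ceil (t₀ - s)).trans (Nat.cast_le.2 hk)
    linarith
  have hcauchy : ∀ s, UniformCauchySeqOn (fun k => X (φ k)) atTop (Icc s t₀) := by
    intro s
    rcases lt_or_ge t₀ s with hs | hs
    · simp [Icc_eq_empty_of_lt hs, UniformCauchySeqOn]
    obtain ⟨K, hK⟩ := hv s
    obtain ⟨k₁, hk₁⟩ := eventually_atTop.1 (hev s)
    rw [Metric.uniformCauchySeqOn_iff]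
    intro ε hε
    obtain ⟨k₂, hk₂⟩ := Metric.cauchySeq_iff.1 hlim.cauchySeq (ε / Real.exp (K * (t₀ - s)))
      (by positivity)
    refine ⟨max k₁ k₂, fun m hm n hn t ht => ?_⟩
    have hsol : ∀ k ≥ max k₁ k₂, ∀ t ∈ Icc s t₀,
        HasDerivWithinAt (X (φ k)) (v t (X (φ k) t)) (Icc s t₀) t ∧ X (φ k) t ∈ D t := by
      intro k hk t ht
      have h1 := hk₁ k ((le_max_left _ _).trans hk)
      have h2 := hX (φ k) t ⟨h1.trans ht.1, ht.2⟩
      exact ⟨h2.1.mono (Icc_subset_Icc_left h1), h2.2⟩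
    have hd := hk₂ m ((le_max_right _ _).trans hm) n ((le_max_right _ _).trans hn)
    rw [lt_div_iff₀ (Real.exp_pos _)] at hd
    refine lt_of_le_of_lt ?_ hd
    refine (dist_le_of_trajectories_backward hK (fun t ht => (hsol m hm t ht).1)
      (fun t ht => (hsol m hm t ht).2) (fun t ht => (hsol n hn t ht).1)
      (fun t ht => (hsol n hn t ht).2) t ht).trans ?_
    simp only [Function.comp_apply]
    gcongr
    exact ht.1
  have hpt : ∀ t : ℝ, ∃ y, t ≤ t₀ → Tendsto (fun k => X (φ k) t) atTop (𝓝 y) := by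
    intro t
    by_cases ht : t ≤ t₀
    · have : CauchySeq (fun k => X (φ k) t) :=
        (hcauchy t).cauchy_map ⟨le_rfl, ht⟩
      exact (cauchySeq_tendsto_of_complete this).imp fun y hy _ => hy
    · exact ⟨0, fun h => absurd h ht⟩
  choose x hx using hpt
  have hxD : ∀ t ≤ t₀, x t ∈ D t := by
    intro t ht
    refine (hD t).mem_of_tendsto (hx t ht) ?_
    filter_upwards [hev t] with k hk
    exact (hX (φ k) t ⟨hk, ht⟩).2
  refine ⟨x, fun t ht => ⟨?_, hxD t ht.le⟩⟩
  obtain ⟨K, hK⟩ := hv (t - 1)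
  have hunif : TendstoUniformlyOn (fun k => X (φ k)) x atTop (Icc (t - 1) t₀) :=
    (hcauchy (t - 1)).tendstoUniformlyOn_of_tendsto fun τ hτ => hx τ hτ.2
  refine hasDerivAt_of_tendstoLocallyUniformlyOn (l := atTop) (s := Ioo (t - 1) t₀)
    (f := fun k => X (φ k)) (f' := fun k τ => v τ (X (φ k) τ)) (g' := fun τ => v τ (x τ))
    isOpen_Ioo ?_ ?_ (fun τ hτ => hx τ hτ.2.le) ⟨by linarith, ht⟩
  · refine TendstoUniformlyOn.tendstoLocallyUniformlyOn ?_
    rw [Metric.tendstoUniformlyOn_iff] at hunif ⊢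
    intro ε hε
    filter_upwards [hunif (ε / (K + 1)) (by positivity), hev (t - 1)] with k hk hk' τ hτ
    have hτ' : τ ∈ Icc (t - 1) t₀ := Ioo_subset_Icc_self hτ
    have h1 := hk τ hτ'
    rw [lt_div_iff₀ (by positivity)] at h1
    have h2 := (hK τ hτ').dist_le_mul _ (hxD τ hτ'.2) _
      (hX (φ k) τ ⟨hk'.trans hτ'.1, hτ'.2⟩).2
    nlinarith [dist_nonneg (x := x τ) (y := X (φ k) τ)]
  · filter_upwards [hev (t - 1)] with k hk τ hτ
    refine ((hX (φ k) τ ⟨hk.trans hτ.1.le, hτ.2.le⟩).1).hasDerivAt ?_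
    exact Icc_mem_nhds (lt_of_le_of_lt hk hτ.1) hτ.2

end ODE

/-! ### The Lyapunov function -/

/-- The quadratic form used as a Lyapunov function. -/
noncomputable def energy (κ Z η w : ℝ) : ℝ := η ^ 2 / 2 + Z * w ^ 2 / 2 - κ * η * w

/-- The right-hand side of the equation for the slope deviation `η`. -/
noncomputable def slopeRate (n Z ρ Q η w : ℝ) : ℝ :=
  ρ * (Z * Real.exp w) - (n - 2) * (2 + η) + (Q - 1) * (2 + η) ^ 2

/-- The derivative of the energy along the system `η' = slopeRate`, `w' = -η`. -/
noncomputable def energyRate (n Z κ ρ Q η w : ℝ) : ℝ :=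
  (η - κ * w) * slopeRate n Z ρ Q η w + (Z * w - κ * η) * (-η)

/-- Since `κ² ≤ Z / 4`, completing the square absorbs the cross term `κ η w` in half of the
diagonal. -/
theorem energy_lower {κ Z η w : ℝ} (hκ : κ ^ 2 ≤ Z / 4) :
    η ^ 2 / 4 + Z * w ^ 2 / 4 ≤ energy κ Z η w := by
  unfold energy
  nlinarith [sq_nonneg (η / 2 - κ * w), mul_nonneg (sub_nonneg.2 hκ) (sq_nonneg w)]

theorem energy_upper {κ Z η w : ℝ} (hZ : 0 < Z) (hκ : κ ^ 2 ≤ Z / 4) :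
    energy κ Z η w ≤ (1 + Z) * (η ^ 2 + w ^ 2) := by
  unfold energy
  nlinarith [sq_nonneg (η / 2 + κ * w), mul_nonneg (sub_nonneg.2 hκ) (sq_nonneg w),
    sq_nonneg η, sq_nonneg w, mul_nonneg hZ.le (sq_nonneg η), mul_nonneg hZ.le (sq_nonneg w)]

/-- The choice `Z = 2n - 4q` cancels the constant terms. What remains is a quadratic form, a
remainder of third order, and an error linear in `ρ - 1` and `Q - q`. -/
theorem energyRate_eq (n q κ ρ Q η w : ℝ) :
    energyRate n (2 * n - 4 * q) κ ρ Q η w =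
      -((n + 2 - 4 * q - κ) * η ^ 2 - κ * (n + 2 - 4 * q) * η * w
          + κ * (2 * n - 4 * q) * w ^ 2)
      + (η - κ * w) * ((2 * n - 4 * q) * (Real.exp w - 1 - w) + (q - 1) * η ^ 2)
      + (η - κ * w) * ((ρ - 1) * ((2 * n - 4 * q) * Real.exp w) + (Q - q) * (2 + η) ^ 2) := by
  unfold energyRate slopeRate
  ring

/-- Friction alone only damps `η`; the cross term of the energy supplies the damping `κ Z w²`.
Young's inequality absorbs the mixed term when `κ` is small. -/
theorem quadratic_lower {a Z κ lam η w : ℝ} (hZ : 0 < Z) (hκ : 0 < κ)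
    (h1 : κ * (1 + a ^ 2 / (2 * Z)) ≤ a / 2) (hl1 : lam ≤ a / 2) (hl2 : lam ≤ κ * Z / 2) :
    lam * (η ^ 2 + w ^ 2) ≤ (a - κ) * η ^ 2 - κ * a * η * w + κ * Z * w ^ 2 := by
  have h2 : κ * a * η * w ≤ κ * Z / 2 * w ^ 2 + κ * (a ^ 2 / (2 * Z)) * η ^ 2 := by
    have : 0 ≤ κ / (2 * Z) * (Z * w - a * η) ^ 2 := by positivity
    have e : κ / (2 * Z) * (Z * w - a * η) ^ 2
        = κ * Z / 2 * w ^ 2 + κ * (a ^ 2 / (2 * Z)) * η ^ 2 - κ * a * η * w := by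
      field_simp
      ring
    linarith
  have h3 := mul_le_mul_of_nonneg_right h1 (sq_nonneg η)
  have h4 := mul_le_mul_of_nonneg_right hl1 (sq_nonneg η)
  have h5 := mul_le_mul_of_nonneg_right hl2 (sq_nonneg w)
  linarith

theorem exists_lyapunov {n q : ℝ} (ha : 0 < n + 2 - 4 * q) (hZ : 0 < 2 * n - 4 * q) :
    ∃ κ ε₀ : ℝ, 0 < ε₀ ∧ κ ^ 2 ≤ (2 * n - 4 * q) / 4 ∧
      (∀ η w : ℝ, energy κ (2 * n - 4 * q) η w ≤ ε₀ → |η| ≤ 1 ∧ |w| ≤ 1) ∧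
      ∀ ε : ℝ, 0 < ε → ∃ δ c : ℝ, 0 < δ ∧ 0 < c ∧ ∀ η w ρ Q : ℝ,
        ε ≤ energy κ (2 * n - 4 * q) η w → energy κ (2 * n - 4 * q) η w ≤ ε₀ →
        |ρ - 1| ≤ δ → |Q - q| ≤ δ →
        energyRate n (2 * n - 4 * q) κ ρ Q η w ≤ -c := by
  have hrate := energyRate_eq n q
  generalize h_a : n + 2 - 4 * q = a at *
  generalize h_Z : 2 * n - 4 * q = Z at *
  obtain ⟨κ, hκ0, hκ1, hκ2, hκ3⟩ : ∃ κ : ℝ, 0 < κ ∧ κ ≤ 1 ∧ κ ≤ Real.sqrt (Z / 4) ∧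
      κ ≤ a / 2 / (1 + a ^ 2 / (2 * Z)) := by
    refine ⟨min 1 (min (Real.sqrt (Z / 4)) (a / 2 / (1 + a ^ 2 / (2 * Z)))), ?_, ?_, ?_, ?_⟩
    · have : 0 < Real.sqrt (Z / 4) := Real.sqrt_pos.2 (by positivity)
      have : 0 < a / 2 / (1 + a ^ 2 / (2 * Z)) := by positivity
      simp [*]
    · exact min_le_left _ _
    · exact (min_le_right _ _).trans (min_le_left _ _)
    · exact (min_le_right _ _).trans (min_le_right _ _)
  rw [le_div_iff₀ (by positivity)] at hκ3
  have hκZ : κ ^ 2 ≤ Z / 4 := (Real.le_sqrt hκ0.le (by positivity)).1 hκ2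
  obtain ⟨lam, hl0, hl1, hl2⟩ : ∃ lam : ℝ, 0 < lam ∧ lam ≤ a / 2 ∧ lam ≤ κ * Z / 2 :=
    ⟨min (a / 2) (κ * Z / 2), by positivity, min_le_left _ _, min_le_right _ _⟩
  -- The scale `s` is chosen so that on `|η|, |w| ≤ s` the third-order remainder costs at most half
  -- of the damping `lam (η² + w²)`.
  have hC : 0 < 4 * (Z + |q - 1|) := by positivity
  obtain ⟨s, hs0, hs1, hs2⟩ : ∃ s : ℝ, 0 < s ∧ s ≤ 1 ∧ s * (4 * (Z + |q - 1|)) ≤ lam :=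
    ⟨min 1 (lam / (4 * (Z + |q - 1|))), by positivity, min_le_left _ _,
      (le_div_iff₀ hC).1 (min_le_right _ _)⟩
  have hsmall : ∀ η w : ℝ, energy κ Z η w ≤ min (s ^ 2 / 4) (Z * s ^ 2 / 4) →
      |η| ≤ s ∧ |w| ≤ s := by
    intro η w h
    have hlow := energy_lower (η := η) (w := w) hκZ
    have h1 := h.trans (min_le_left _ _)
    have h2 := h.trans (min_le_right _ _)
    constructor
    · refine abs_le_of_sq_le_sq ?_ hs0.le
      nlinarith [mul_nonneg hZ.le (sq_nonneg w)]
    · refine abs_le_of_sq_le_sq ?_ hs0.le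
      refine le_of_mul_le_mul_left ?_ hZ
      nlinarith [sq_nonneg η]
  refine ⟨κ, min (s ^ 2 / 4) (Z * s ^ 2 / 4), by positivity, hκZ, ?_, ?_⟩
  · intro η w h
    exact ⟨(hsmall η w h).1.trans hs1, (hsmall η w h).2.trans hs1⟩
  intro ε hε
  have hD : 0 < 6 * Z + 18 := by positivity
  -- Above level `ε` the damping is at least `4c`. Half of it survives the third-order remainder,
  -- and `δ` bounds the error in `ρ` and `Q` by `c`, leaving a rate of at most `-c`.
  refine ⟨lam * ε / (4 * (1 + Z)) / (6 * Z + 18), lam * ε / (4 * (1 + Z)), by positivity,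
    by positivity, ?_⟩
  intro η w ρ Q h1 h2 hρ hQ
  set c := lam * ε / (4 * (1 + Z)) with hc
  have hc0 : 0 < c := by positivity
  set δ := c / (6 * Z + 18) with hδ
  have hδ0 : 0 < δ := by positivity
  have hδc : δ * (6 * Z + 18) = c := by rw [hδ]; field_simp
  obtain ⟨hη, hw⟩ := hsmall η w h2
  have hη1 := hη.trans hs1
  have hw1 := hw.trans hs1
  have hquad := quadratic_lower (η := η) (w := w) hZ hκ0 hκ3 hl1 hl2
  have hm : |η - κ * w| ≤ 2 * s := by
    have : |κ * w| ≤ s := by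
      rw [abs_mul, abs_of_pos hκ0]
      nlinarith [abs_nonneg w]
    linarith [abs_sub η (κ * w)]
  have hexp : |Real.exp w - 1 - w| ≤ w ^ 2 := Real.abs_exp_sub_one_sub_id_le hw1
  have hexp3 : Real.exp w ≤ 3 :=
    (Real.exp_le_exp.2 (abs_le.1 hw1).2).trans Real.exp_one_lt_three.le
  have hcub : |(η - κ * w) * (Z * (Real.exp w - 1 - w) + (q - 1) * η ^ 2)|
      ≤ lam / 2 * (η ^ 2 + w ^ 2) := by
    have h3 : |Z * (Real.exp w - 1 - w) + (q - 1) * η ^ 2|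
        ≤ (Z + |q - 1|) * (η ^ 2 + w ^ 2) := by
      refine (abs_add_le _ _).trans ?_
      rw [abs_mul, abs_mul, abs_of_pos hZ, abs_of_nonneg (sq_nonneg η)]
      have := mul_le_mul_of_nonneg_left hexp hZ.le
      nlinarith [mul_nonneg hZ.le (sq_nonneg η), mul_nonneg (abs_nonneg (q - 1)) (sq_nonneg w)]
    rw [abs_mul]
    calc _ ≤ 2 * s * ((Z + |q - 1|) * (η ^ 2 + w ^ 2)) :=
          mul_le_mul hm h3 (abs_nonneg _) (by positivity)
      _ = s * (4 * (Z + |q - 1|)) / 2 * (η ^ 2 + w ^ 2) := by ring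
      _ ≤ _ := by gcongr
  have hpert : |(η - κ * w) * ((ρ - 1) * (Z * Real.exp w) + (Q - q) * (2 + η) ^ 2)| ≤ c := by
    have h4 : (2 + η) ^ 2 ≤ 9 := by nlinarith [abs_le.1 hη1]
    have h3 : |(ρ - 1) * (Z * Real.exp w) + (Q - q) * (2 + η) ^ 2| ≤ δ * (3 * Z + 9) := by
      refine (abs_add_le _ _).trans ?_
      rw [abs_mul (ρ - 1), abs_mul (Q - q), abs_of_pos (by positivity : 0 < Z * Real.exp w),
        abs_of_nonneg (sq_nonneg (2 + η))]
      have e1 : |ρ - 1| * (Z * Real.exp w) ≤ δ * (Z * 3) := by gcongr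
      have e2 : |Q - q| * (2 + η) ^ 2 ≤ δ * 9 := by gcongr
      linarith
    rw [abs_mul]
    calc _ ≤ 2 * (δ * (3 * Z + 9)) :=
          mul_le_mul (by linarith) h3 (abs_nonneg _) (by positivity)
      _ = c := by rw [← hδc]; ring
  have hS : 4 * c ≤ lam * (η ^ 2 + w ^ 2) := by
    have h5 := h1.trans (energy_upper hZ hκZ)
    have : 4 * c = lam * (ε / (1 + Z)) := by rw [hc]; field_simp
    rw [this]
    gcongr
    rw [div_le_iff₀ (by positivity)]
    linarith
  rw [hrate]
  linarith [le_abs_self ((η - κ * w) * (Z * (Real.exp w - 1 - w) + (q - 1) * η ^ 2)),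
    le_abs_self ((η - κ * w) * ((ρ - 1) * (Z * Real.exp w) + (Q - q) * (2 + η) ^ 2))]

/-! ### Logarithmic coordinates and a priori bounds -/

/-- Logarithmic deviation of the tail integral from `exp (2 * t) / Z`. -/
noncomputable def logDev (f₀ : ℝ → ℝ) (Z t U : ℝ) : ℝ :=
  2 * t - Real.log (Z * tailIntegral f₀ U)

/-- Deviation from `2` of the logarithmic slope of the tail integral along a curve. -/
noncomputable def slopeDev (f₀ : ℝ → ℝ) (U P : ℝ) : ℝ :=
  -P / (f₀ U * tailIntegral f₀ U) - 2

/-- The energy of a state of the radial equation at the logarithmic time `t`. -/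
noncomputable def stateEnergy (f₀ : ℝ → ℝ) (Z κ t : ℝ) (x : ℝ × ℝ) : ℝ :=
  energy κ Z (slopeDev f₀ x.1 x.2) (logDev f₀ Z t x.1)

/-- The radial equation in the variable `t = log r`, as a first-order system for `(U, dU/dt)`. -/
noncomputable def emdenField (n : ℝ) (f : ℝ → ℝ) (t : ℝ) (x : ℝ × ℝ) : ℝ × ℝ :=
  (x.2, -(n - 2) * x.2 - Real.exp (2 * t) * f x.1)

section Energy

variable {f f₀ : ℝ → ℝ} {n Z κ : ℝ}

/-- From `F₀' = -1/f₀`, the logarithmic slope of `F₀(U)` is `2 + η`, so `w' = -η`; in `η'` the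
factor `exp (2t) / F₀(U)` equals `Z e^w`. -/
theorem hasDerivWithinAt_stateEnergy (hg : ContDiffOn ℝ 1 f₀ (Ici 0))
    (hpos : ∀ u, 0 < u → 0 < f₀ u) (hfin : TailFinite f₀) (hZ : 0 < Z)
    {x : ℝ → ℝ × ℝ} {s : Set ℝ} {t : ℝ} (hx : HasDerivWithinAt x (emdenField n f t (x t)) s t)
    (hU : 0 < (x t).1) :
    HasDerivWithinAt (fun τ => stateEnergy f₀ Z κ τ (x τ))
      (energyRate n Z κ (f (x t).1 / f₀ (x t).1) (deriv f₀ (x t).1 * tailIntegral f₀ (x t).1)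
        (slopeDev f₀ (x t).1 (x t).2) (logDev f₀ Z t (x t).1)) s t := by
  have h1 : HasDerivWithinAt (fun τ => (x τ).1) (x t).2 s t := hx.fst
  have h2 : HasDerivWithinAt (fun τ => (x τ).2)
      (-(n - 2) * (x t).2 - Real.exp (2 * t) * f (x t).1) s t := hx.snd
  have hF : HasDerivWithinAt (fun τ => tailIntegral f₀ (x τ).1)
      (-(1 / f₀ (x t).1) * (x t).2) s t :=
    (hasDerivAt_tailIntegral hg hpos hfin hU).comp_hasDerivWithinAt (h := fun τ => (x τ).1) t h1
  have hf₀ : HasDerivWithinAt (fun τ => f₀ (x τ).1) (deriv f₀ (x t).1 * (x t).2) s t :=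
    (hasDerivAt_of_contDiffOn_Ici hg hU).comp_hasDerivWithinAt (h := fun τ => (x τ).1) t h1
  have hFpos := tailIntegral_pos hg hpos hfin hU
  have hf₀pos := hpos _ hU
  have hlog : HasDerivWithinAt (fun τ => logDev f₀ Z τ (x τ).1)
      (-slopeDev f₀ (x t).1 (x t).2) s t := by
    have h := ((hasDerivWithinAt_id t s).const_mul 2).sub
      ((hF.const_mul Z).log (by positivity))
    refine h.congr_deriv ?_
    unfold slopeDev
    field_simp
    ring
  have hexp : Z * Real.exp (logDev f₀ Z t (x t).1)
      = Real.exp (2 * t) / tailIntegral f₀ (x t).1 := by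
    unfold logDev
    rw [Real.exp_sub, Real.exp_log (by positivity)]
    field_simp
  have hslope : HasDerivWithinAt (fun τ => slopeDev f₀ (x τ).1 (x τ).2)
      (slopeRate n Z (f (x t).1 / f₀ (x t).1) (deriv f₀ (x t).1 * tailIntegral f₀ (x t).1)
        (slopeDev f₀ (x t).1 (x t).2) (logDev f₀ Z t (x t).1)) s t := by
    have h := (h2.fun_neg.fun_div (hf₀.fun_mul hF) (mul_pos hf₀pos hFpos).ne').sub_const 2
    refine h.congr_deriv ?_
    unfold slopeRate
    rw [hexp]
    unfold slopeDev
    field_simp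
    ring
  have h := (((hslope.pow 2).div_const 2).add (((hlog.pow 2).const_mul Z).div_const 2)).sub
    ((hslope.const_mul κ).mul hlog)
  refine h.congr_deriv ?_
  unfold energyRate
  simp
  ring

theorem continuousOn_stateEnergy (hg : ContDiffOn ℝ 1 f₀ (Ici 0))
    (hpos : ∀ u, 0 < u → 0 < f₀ u) (hfin : TailFinite f₀) (hZ : 0 < Z) :
    ContinuousOn (fun p : ℝ × ℝ × ℝ => stateEnergy f₀ Z κ p.1 p.2) {p | 0 < p.2.1} := by
  have hF : ContinuousOn (fun p : ℝ × ℝ × ℝ => tailIntegral f₀ p.2.1) {p | 0 < p.2.1} :=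
    (continuousOn_tailIntegral hg hpos hfin).comp (by fun_prop) fun p hp => hp
  have hf₀ : ContinuousOn (fun p : ℝ × ℝ × ℝ => f₀ p.2.1) {p | 0 < p.2.1} :=
    hg.continuousOn.comp (by fun_prop) fun p hp => le_of_lt (show 0 < p.2.1 from hp)
  have hlog : ContinuousOn (fun p : ℝ × ℝ × ℝ => logDev f₀ Z p.1 p.2.1) {p | 0 < p.2.1} := by
    unfold logDev
    refine ContinuousOn.sub (by fun_prop) ((continuousOn_const.mul hF).log fun p hp => ?_)
    exact (mul_pos hZ (tailIntegral_pos hg hpos hfin hp)).ne'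
  have hslope : ContinuousOn (fun p : ℝ × ℝ × ℝ => slopeDev f₀ p.2.1 p.2.2) {p | 0 < p.2.1} := by
    unfold slopeDev
    refine ContinuousOn.sub (ContinuousOn.div (by fun_prop) (hf₀.mul hF) fun p hp => ?_)
      continuousOn_const
    exact (mul_pos (hpos _ hp) (tailIntegral_pos hg hpos hfin hp)).ne'
  unfold stateEnergy energy
  fun_prop

theorem tailIntegral_eq_exp (hg : ContDiffOn ℝ 1 f₀ (Ici 0))
    (hpos : ∀ u, 0 < u → 0 < f₀ u) (hfin : TailFinite f₀) (hZ : 0 < Z) {t U : ℝ} (hU : 0 < U) :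
    Z * tailIntegral f₀ U = Real.exp (2 * t - logDev f₀ Z t U) := by
  have := tailIntegral_pos hg hpos hfin hU
  rw [logDev, sub_sub_cancel, Real.exp_log (by positivity)]

/-- With `|w| ≤ 1`, `Z F₀(U)` is at most `exp (2t + 1)`. Early times thus force `U` to be large,
which brings `ρ` and `Q` near their limits and keeps trajectories off the edge `U = m`. -/
theorem lt_of_abs_logDev_le (hg : ContDiffOn ℝ 1 f₀ (Ici 0))
    (hpos : ∀ u, 0 < u → 0 < f₀ u) (hfin : TailFinite f₀) (hZ : 0 < Z) {t₀ t m U : ℝ}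
    (hU : 0 < U) (hw : |logDev f₀ Z t U| ≤ 1) (ht : t ≤ t₀) (hm : 0 < m)
    (hmZ : Real.exp (2 * t₀ + 1) < Z * tailIntegral f₀ m) : m < U := by
  have h := tailIntegral_eq_exp hg hpos hfin hZ (t := t) hU
  refine ((strictAntiOn_tailIntegral hg hpos hfin).lt_iff_gt hU hm).1 ?_
  refine lt_of_mul_lt_mul_left (lt_of_le_of_lt ?_ hmZ) hZ.le
  rw [h, Real.exp_le_exp]
  linarith [(abs_le.1 hw).1]

theorem gt_of_abs_logDev_le (hg : ContDiffOn ℝ 1 f₀ (Ici 0))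
    (hpos : ∀ u, 0 < u → 0 < f₀ u) (hfin : TailFinite f₀) (hZ : 0 < Z) {s t M U : ℝ}
    (hU : 0 < U) (hw : |logDev f₀ Z t U| ≤ 1) (ht : s ≤ t) (hM : 0 < M)
    (hMZ : Z * tailIntegral f₀ M < Real.exp (2 * s - 1)) : U < M := by
  have h := tailIntegral_eq_exp hg hpos hfin hZ (t := t) hU
  refine ((strictAntiOn_tailIntegral hg hpos hfin).lt_iff_gt hM hU).1 ?_
  refine lt_of_mul_lt_mul_left (lt_of_lt_of_le hMZ ?_) hZ.le
  rw [h, Real.exp_le_exp]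
  linarith [(abs_le.1 hw).2]

theorem exists_tailIntegral_lt {ε : ℝ} (hε : 0 < ε) (m : ℝ) :
    ∃ M : ℝ, m < M ∧ Z * tailIntegral f₀ M < ε := by
  have h : Tendsto (fun u => Z * tailIntegral f₀ u) atTop (𝓝 0) := by
    simpa using tendsto_tailIntegral_atTop.const_mul Z
  exact ((eventually_gt_atTop m).and (h.eventually_lt_const hε)).exists

theorem abs_le_of_abs_slopeDev_le (hg : ContDiffOn ℝ 1 f₀ (Ici 0))
    (hpos : ∀ u, 0 < u → 0 < f₀ u) (hfin : TailFinite f₀) {U P : ℝ} (hU : 0 < U)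
    (hη : |slopeDev f₀ U P| ≤ 1) : |P| ≤ 3 * (f₀ U * tailIntegral f₀ U) := by
  have hp : 0 < f₀ U * tailIntegral f₀ U :=
    mul_pos (hpos _ hU) (tailIntegral_pos hg hpos hfin hU)
  have h : P = -(2 + slopeDev f₀ U P) * (f₀ U * tailIntegral f₀ U) := by
    have := hp.ne'
    rw [slopeDev, add_sub_cancel, ← neg_div, neg_neg, div_mul_cancel₀ _ this]
  rw [h, abs_mul, abs_of_pos hp, abs_neg]
  gcongr
  rw [abs_le] at hη ⊢
  constructor <;> linarith

theorem exists_slope_bound (hg : ContDiffOn ℝ 1 f₀ (Ici 0))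
    (hpos : ∀ u, 0 < u → 0 < f₀ u) (hfin : TailFinite f₀) {m M : ℝ} (hm : 0 < m) :
    ∃ B : ℝ, 0 < B ∧ ∀ U ∈ Icc m M, ∀ P, |slopeDev f₀ U P| ≤ 1 → |P| < B := by
  have hc : ContinuousOn (fun U => f₀ U * tailIntegral f₀ U) (Icc m M) :=
    (hg.continuousOn.mono fun U hU => hm.le.trans hU.1).mul
      ((continuousOn_tailIntegral hg hpos hfin).mono fun U hU => hm.trans_le hU.1)
  obtain ⟨C, hC⟩ := isCompact_Icc.exists_bound_of_continuousOn hc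
  refine ⟨3 * |C| + 1, by positivity, fun U hU P hP => ?_⟩
  have h1 := abs_le_of_abs_slopeDev_le hg hpos hfin (hm.trans_le hU.1) hP
  have h2 := (le_abs_self _).trans ((hC U hU).trans (le_abs_self C))
  linarith

theorem exists_lipschitz_emdenField (hf : ContDiffOn ℝ 1 f (Ici 0)) {m M : ℝ} (hm : 0 ≤ m)
    (n t₀ : ℝ) : ∃ K : ℝ≥0, ∀ t ≤ t₀,
      LipschitzOnWith K (emdenField n f t) {x : ℝ × ℝ | x.1 ∈ Icc m M} := by
  obtain ⟨K, hK⟩ := (hf.mono fun u hu => hm.trans hu.1 :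
    ContDiffOn ℝ 1 f (Icc m M)).exists_lipschitzOnWith one_ne_zero (convex_Icc m M) isCompact_Icc
  refine ⟨1 + ‖n - 2‖₊ + (Real.exp (2 * t₀)).toNNReal * K, fun t ht => ?_⟩
  refine LipschitzOnWith.of_dist_le_mul fun x hx y hy => ?_
  have h1 : |x.1 - y.1| ≤ dist x y := by rw [← Real.dist_eq]; exact le_max_left _ _
  have h2 : |x.2 - y.2| ≤ dist x y := by rw [← Real.dist_eq]; exact le_max_right _ _
  have h3 : |f x.1 - f y.1| ≤ K * dist x y := by
    have := hK.dist_le_mul _ hx _ hy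
    rw [Real.dist_eq, Real.dist_eq] at this
    exact this.trans (by gcongr)
  have h4 : Real.exp (2 * t) ≤ Real.exp (2 * t₀) := by gcongr
  simp only [NNReal.coe_add, NNReal.coe_mul, NNReal.coe_one, coe_nnnorm, Real.norm_eq_abs,
    Real.coe_toNNReal _ (Real.exp_pos _).le]
  have hd := dist_nonneg (x := x) (y := y)
  have e1 : |n - 2| * |x.2 - y.2| ≤ |n - 2| * dist x y := by gcongr
  have e2 : Real.exp (2 * t) * |f x.1 - f y.1| ≤ Real.exp (2 * t₀) * (K * dist x y) := by gcongr
  have e3 : 0 ≤ |n - 2| * dist x y := by positivity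
  have e4 : 0 ≤ Real.exp (2 * t₀) * (K * dist x y) := by positivity
  rw [Prod.dist_eq]
  refine max_le ?_ ?_
  · rw [Real.dist_eq]
    simp only [emdenField]
    linarith
  · rw [Real.dist_eq]
    simp only [emdenField]
    have e : -(n - 2) * x.2 - Real.exp (2 * t) * f x.1
        - (-(n - 2) * y.2 - Real.exp (2 * t) * f y.1)
        = -((n - 2) * (x.2 - y.2)) - Real.exp (2 * t) * (f x.1 - f y.1) := by ring
    rw [e]
    refine (abs_sub _ _).trans ?_
    rw [abs_neg, abs_mul, abs_mul, abs_of_pos (Real.exp_pos _)]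
    linarith

theorem eventually_lt_of_hasDerivWithinAt_neg {g : ℝ → ℝ} {g' a b t : ℝ}
    (hg : HasDerivWithinAt g g' (Icc a b) t) (ht : t ∈ Ico a b) (hneg : g' < 0) :
    ∀ᶠ z in 𝓝[>] t, g z < g t := by
  have h : HasDerivWithinAt g g' (Ioi t) t :=
    hg.mono_of_mem_nhdsWithin (mem_of_superset (Ioc_mem_nhdsGT ht.2)
      fun z hz => ⟨ht.1.trans hz.1.le, hz.2⟩)
  have hs := (hasDerivWithinAt_iff_tendsto_slope' (by simp)).1 h
  filter_upwards [hs.eventually_lt_const hneg, self_mem_nhdsWithin] with z hz hz'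
  rw [slope_def_field, div_neg_iff] at hz
  have : t < z := hz'
  rcases hz with hz | hz <;> linarith

end Energy

/-! ### Trapping in an energy sublevel -/

/-- The states to the right of `m` whose energy at time `t` is at most `ε`. -/
def trap (f₀ : ℝ → ℝ) (Z κ ε m t : ℝ) : Set (ℝ × ℝ) :=
  {x | m ≤ x.1 ∧ stateEnergy f₀ Z κ t x ≤ ε}

theorem coe_projIcc_eq_of_mem_Ioo {a b x : ℝ} (h : a ≤ b)
    (hx : (projIcc a b h x : ℝ) ∈ Ioo a b) : (projIcc a b h x : ℝ) = x := by
  rw [coe_projIcc] at hx ⊢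
  rcases le_total b x with h1 | h1
  · simp [h1, h] at hx
  · rcases le_total x a with h2 | h2
    · simp [h1, h2] at hx
    · simp [h1, h2]

section Trapping

variable {f f₀ : ℝ → ℝ} {n Z κ ε₀ : ℝ}

theorem isClosed_trap (hg : ContDiffOn ℝ 1 f₀ (Ici 0)) (hpos : ∀ u, 0 < u → 0 < f₀ u)
    (hfin : TailFinite f₀) (hZ : 0 < Z) {m : ℝ} (hm : 0 < m) (ε t : ℝ) :
    IsClosed (trap f₀ Z κ ε m t) := by
  have h1 : IsClosed {x : ℝ × ℝ | m ≤ x.1} := isClosed_le continuous_const continuous_fst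
  have h2 : ContinuousOn (stateEnergy f₀ Z κ t) {x : ℝ × ℝ | m ≤ x.1} :=
    (continuousOn_stateEnergy hg hpos hfin hZ).comp (f := fun x : ℝ × ℝ => (t, x))
      (by fun_prop) fun x hx => hm.trans_le hx
  exact h2.preimage_isClosed_of_isClosed h1 isClosed_Iic

/-- The box must depend on `s`, because `U` is unbounded as `t → -∞`. Its upper and slope bounds are
strict, so a trapped state never touches these sides. -/
theorem exists_trap_subset (hg : ContDiffOn ℝ 1 f₀ (Ici 0)) (hpos : ∀ u, 0 < u → 0 < f₀ u)
    (hfin : TailFinite f₀)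
    (hsmall : ∀ η w : ℝ, energy κ Z η w ≤ ε₀ → |η| ≤ 1 ∧ |w| ≤ 1) (hZ : 0 < Z) {m : ℝ}
    (hm : 0 < m) (s : ℝ) :
    ∃ M B : ℝ, m < M ∧ 0 < B ∧ Z * tailIntegral f₀ M < Real.exp (2 * s - 1) ∧
      ∀ t ≥ s, ∀ x ∈ trap f₀ Z κ ε₀ m t, x.1 < M ∧ |x.2| < B := by
  obtain ⟨M, hmM, hM⟩ := exists_tailIntegral_lt (f₀ := f₀) (Z := Z)
    (Real.exp_pos (2 * s - 1)) m
  obtain ⟨B, hB0, hB⟩ := exists_slope_bound hg hpos hfin (M := M) hm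
  refine ⟨M, B, hmM, hB0, hM, fun t ht x hx => ?_⟩
  obtain ⟨hη, hw⟩ := hsmall _ _ hx.2
  have h1 := gt_of_abs_logDev_le hg hpos hfin hZ (hm.trans_le hx.1) hw ht (hm.trans hmM) hM
  exact ⟨h1, hB _ ⟨hx.1, h1.le⟩ _ hη⟩

theorem isCompact_trap (hg : ContDiffOn ℝ 1 f₀ (Ici 0)) (hpos : ∀ u, 0 < u → 0 < f₀ u)
    (hfin : TailFinite f₀)
    (hsmall : ∀ η w : ℝ, energy κ Z η w ≤ ε₀ → |η| ≤ 1 ∧ |w| ≤ 1) (hZ : 0 < Z) {m : ℝ}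
    (hm : 0 < m) (t : ℝ) : IsCompact (trap f₀ Z κ ε₀ m t) := by
  obtain ⟨M, B, -, -, -, h⟩ := exists_trap_subset hg hpos hfin hsmall hZ hm t
  refine (isCompact_Icc.prod isCompact_Icc : IsCompact (Icc m M ×ˢ Icc (-B) B)).of_isClosed_subset
    (isClosed_trap hg hpos hfin hZ hm ε₀ t) fun x hx => ?_
  obtain ⟨h1, h2⟩ := h t le_rfl x hx
  exact ⟨⟨hx.1, h1.le⟩, abs_le.1 h2.le⟩

theorem exists_equilibrium_state (hg : ContDiffOn ℝ 1 f₀ (Ici 0))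
    (hpos : ∀ u, 0 < u → 0 < f₀ u) (hfin : TailFinite f₀) {s t₀ m M : ℝ}
    (hm : 0 < m) (hmM : m ≤ M) (hs : s ≤ t₀)
    (hmZ : Real.exp (2 * t₀ + 1) < Z * tailIntegral f₀ m)
    (hMZ : Z * tailIntegral f₀ M < Real.exp (2 * s - 1)) :
    ∃ x : ℝ × ℝ, x.1 ∈ Icc m M ∧ stateEnergy f₀ Z κ s x = 0 := by
  have hc : ContinuousOn (fun U => Z * tailIntegral f₀ U) (Icc m M) :=
    continuousOn_const.mul
      ((continuousOn_tailIntegral hg hpos hfin).mono fun U hU => hm.trans_le hU.1)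
  have h1 : Z * tailIntegral f₀ M ≤ Real.exp (2 * s) :=
    hMZ.le.trans (Real.exp_le_exp.2 (by linarith))
  have h2 : Real.exp (2 * s) ≤ Z * tailIntegral f₀ m :=
    (Real.exp_le_exp.2 (by linarith)).trans hmZ.le
  obtain ⟨U, hU, hUeq⟩ := intermediate_value_Icc' hmM hc ⟨h1, h2⟩
  have hU0 := hm.trans_le hU.1
  have hne : f₀ U * tailIntegral f₀ U ≠ 0 :=
    (mul_pos (hpos _ hU0) (tailIntegral_pos hg hpos hfin hU0)).ne'
  -- This slope makes `η = 0`, while the intermediate value theorem chose `U` with `w = 0`.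
  refine ⟨(U, -2 * (f₀ U * tailIntegral f₀ U)), hU, ?_⟩
  have hw : logDev f₀ Z s U = 0 := by
    simp only at hUeq
    rw [logDev, hUeq, Real.log_exp, sub_self]
  have hη : slopeDev f₀ U (-2 * (f₀ U * tailIntegral f₀ U)) = 0 := by
    rw [slopeDev, neg_mul, neg_neg, mul_div_cancel_right₀ _ hne, sub_self]
  simp only [stateEnergy, energy, hw, hη]
  ring

/-- Starting from the equilibrium state at time `s`, the system has a solution on `[s, t₀]` that
stays in the trap, provided that the energy decreases along the flow on the boundary. -/
theorem exists_trapped_solution (hf : ContDiffOn ℝ 1 f (Ici 0))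
    (hg : ContDiffOn ℝ 1 f₀ (Ici 0)) (hpos : ∀ u, 0 < u → 0 < f₀ u)
    (hfin : TailFinite f₀) (hZ : 0 < Z) (hε₀ : 0 < ε₀)
    (hsmall : ∀ η w : ℝ, energy κ Z η w ≤ ε₀ → |η| ≤ 1 ∧ |w| ≤ 1)
    {s t₀ m : ℝ} (hm : 0 < m) (hs : s ≤ t₀)
    (hmZ : Real.exp (2 * t₀ + 1) < Z * tailIntegral f₀ m)
    (hdec : ∀ U, m ≤ U → ∀ η w, energy κ Z η w = ε₀ →
      energyRate n Z κ (f U / f₀ U) (deriv f₀ U * tailIntegral f₀ U) η w < 0) :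
    ∃ x : ℝ → ℝ × ℝ, ∀ t ∈ Icc s t₀,
      HasDerivWithinAt x (emdenField n f t (x t)) (Icc s t₀) t ∧ x t ∈ trap f₀ Z κ ε₀ m t := by
  obtain ⟨M, B, hmM, hB0, hMZ, hbd⟩ := exists_trap_subset hg hpos hfin hsmall hZ hm s
  obtain ⟨x₀, hx₀, hx₀E⟩ := exists_equilibrium_state (κ := κ) hg hpos hfin hm hmM.le hs hmZ hMZ
  have hBB : -B ≤ B := by linarith
  -- Clamping to the box makes the field bounded and globally Lipschitz; the clamp turns out to be
  -- inactive along the solution.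
  let P : ℝ × ℝ → ℝ × ℝ := fun x => ((projIcc m M hmM.le x.1 : ℝ), (projIcc (-B) B hBB x.2 : ℝ))
  have hPlip : LipschitzWith 1 P := by
    refine LipschitzWith.of_dist_le_mul fun x y => ?_
    have h1 := (LipschitzWith.projIcc hmM.le).dist_le_mul x.1 y.1
    have h2 := (LipschitzWith.projIcc hBB).dist_le_mul x.2 y.2
    simp only [NNReal.coe_one, one_mul, Subtype.dist_eq] at h1 h2 ⊢
    exact max_le_max h1 h2
  have hPmem : ∀ x, P x ∈ Icc m M ×ˢ Icc (-B) B := fun x =>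
    ⟨(projIcc m M hmM.le x.1).2, (projIcc (-B) B hBB x.2).2⟩
  obtain ⟨K, hK⟩ := exists_lipschitz_emdenField hf (M := M) hm.le n t₀
  have hfield : ContinuousOn (fun p : ℝ × ℝ × ℝ => emdenField n f p.1 p.2)
      (Icc s t₀ ×ˢ (Icc m M ×ˢ Icc (-B) B)) := by
    have : ContinuousOn (fun p : ℝ × ℝ × ℝ => f p.2.1) (Icc s t₀ ×ˢ (Icc m M ×ˢ Icc (-B) B)) :=
      hf.continuousOn.comp (by fun_prop) fun p hp => hm.le.trans hp.2.1.1
    exact ContinuousOn.prodMk (by fun_prop)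
      (ContinuousOn.sub (by fun_prop) (ContinuousOn.mul (by fun_prop) this))
  obtain ⟨L, hL⟩ := (isCompact_Icc.prod (isCompact_Icc.prod isCompact_Icc) :
    IsCompact (Icc s t₀ ×ˢ (Icc m M ×ˢ Icc (-B) B))).exists_bound_of_continuousOn hfield
  obtain ⟨x, hxs, hx⟩ := exists_solution_of_bounded_lipschitz
    (v := fun t x => emdenField n f t (P x)) (K := K * 1) (L := L.toNNReal) hs
    (fun t ht => by
      rw [← lipschitzOnWith_univ]
      exact (hK t ht.2).comp hPlip.lipschitzOnWith fun y _ => (hPmem y).1)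
    (fun y => hfield.comp (f := fun t => (t, P y)) (by fun_prop) fun t ht => ⟨ht, hPmem y⟩)
    (fun t ht y => (hL (t, P y) ⟨ht, hPmem y⟩).trans (Real.le_coe_toNNReal L)) x₀
  have hxc : ContinuousOn x (Icc s t₀) := fun t ht => (hx t ht).continuousWithinAt
  -- Clamping the first component keeps `G` defined and continuous before positivity of `U` is
  -- known. The second component stays unclamped, so that `G ≤ ε₀` bounds the true slope.
  let G : ℝ → ℝ := fun t => stateEnergy f₀ Z κ t ((projIcc m M hmM.le (x t).1 : ℝ), (x t).2)
  have hGc : ContinuousOn G (Icc s t₀) := by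
    have hc : ContinuousOn (fun t => (projIcc m M hmM.le (x t).1 : ℝ)) (Icc s t₀) :=
      (continuous_subtype_val.comp continuous_projIcc).comp_continuousOn hxc.fst
    exact (continuousOn_stateEnergy hg hpos hfin hZ).comp
      (f := fun t => (t, ((projIcc m M hmM.le (x t).1 : ℝ), (x t).2)))
      (continuousOn_id.prodMk (hc.prodMk hxc.snd))
      fun t _ => hm.trans_le (projIcc m M hmM.le (x t).1).2.1
  have hin : ∀ t ∈ Icc s t₀, G t ≤ ε₀ →
      (x t).1 ∈ Ioo m M ∧ P (x t) = x t ∧ x t ∈ trap f₀ Z κ ε₀ m t := by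
    intro t ht hGt
    have hmem := (projIcc m M hmM.le (x t).1).2
    obtain ⟨h1, h2⟩ := hbd t ht.1 ((projIcc m M hmM.le (x t).1 : ℝ), (x t).2) ⟨hmem.1, hGt⟩
    have h3 : m < (projIcc m M hmM.le (x t).1 : ℝ) :=
      lt_of_abs_logDev_le hg hpos hfin hZ (hm.trans_le hmem.1) (hsmall _ _ hGt).2 ht.2 hm hmZ
    have h4 := coe_projIcc_eq_of_mem_Ioo hmM.le ⟨h3, h1⟩
    have h5 : (projIcc (-B) B hBB (x t).2 : ℝ) = (x t).2 := by
      rw [projIcc_of_mem hBB (abs_le.1 h2.le)]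
    have h6 : G t = stateEnergy f₀ Z κ t (x t) := by simp only [G, h4]
    rw [h4] at h1 h3
    exact ⟨⟨h3, h1⟩, Prod.ext h4 h5, h3.le, h6 ▸ hGt⟩
  -- Continuous induction: below level `ε₀` continuity suffices, and at level `ε₀` the derivative of
  -- the energy is negative.
  have hall : Icc s t₀ ⊆ {t | G t ≤ ε₀} := by
    refine IsClosed.Icc_subset_of_forall_exists_gt ?_ ?_ ?_
    · rw [inter_comm]
      exact hGc.preimage_isClosed_of_isClosed isClosed_Icc isClosed_Iic
    · have : G s = 0 := by
        simp only [G, hxs]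
        rw [projIcc_of_mem hmM.le hx₀]
        exact hx₀E
      exact this.le.trans hε₀.le
    rintro t ⟨hGt, ht⟩ y hy
    have ht' : t ∈ Icc s t₀ := ⟨ht.1, ht.2.le⟩
    have hGcw : ContinuousWithinAt G (Ioi t) t :=
      (hGc t ht').mono_of_mem_nhdsWithin (mem_of_superset (Ioc_mem_nhdsGT ht.2)
        fun z hz => ⟨ht.1.trans hz.1.le, hz.2⟩)
    have hev : ∀ᶠ z in 𝓝[>] t, G z ≤ ε₀ := by
      rcases lt_or_eq_of_le (show G t ≤ ε₀ from hGt) with hlt | heq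
      · exact (hGcw.eventually_lt_const hlt).mono fun z hz => hz.le
      obtain ⟨hU, hP, -⟩ := hin t ht' hGt
      have hxd := hx t ht'
      simp only [hP] at hxd
      have hd := hasDerivWithinAt_stateEnergy (κ := κ) hg hpos hfin hZ hxd (hm.trans hU.1)
      have hGx : G t = stateEnergy f₀ Z κ t (x t) := by
        simp only [G, projIcc_of_mem hmM.le (Ioo_subset_Icc_self hU)]
      have hneg := eventually_lt_of_hasDerivWithinAt_neg hd ht
        (hdec _ hU.1.le _ _ (by rw [← heq, hGx, stateEnergy]))
      have hxt : Tendsto (fun z => (x z).1) (𝓝[>] t) (𝓝 (x t).1) :=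
        (hxc.fst t ht').mono_of_mem_nhdsWithin (mem_of_superset (Ioc_mem_nhdsGT ht.2)
          fun z hz => ⟨ht.1.trans hz.1.le, hz.2⟩)
      filter_upwards [hneg, hxt.eventually (Ioo_mem_nhds hU.1 hU.2)] with z hz hUz
      simp only [G, projIcc_of_mem hmM.le (Ioo_subset_Icc_self hUz)]
      rw [← heq, hGx]
      exact hz.le
    exact (hev.and (Ioc_mem_nhdsGT hy)).exists
  refine ⟨x, fun t ht => ?_⟩
  obtain ⟨-, hP, htrap⟩ := hin t ht (hall ht)
  have hxd := hx t ht
  simp only [hP] at hxd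
  exact ⟨hxd, htrap⟩

/-- A function on `(-∞, t₀)` that is bounded above, and that decreases on `(-∞, T)` at a definite
rate wherever it is at least `ε`, is at most `ε` on `(-∞, T)`. -/
theorem eventually_le_of_deriv_le {g g' : ℝ → ℝ} {t₀ C ε c T : ℝ}
    (hg : ∀ t < t₀, HasDerivAt g (g' t) t) (hC : ∀ t < t₀, g t ≤ C) (hT : T ≤ t₀) (hc : 0 < c)
    (hεC : ε ≤ C) (hdec : ∀ t < T, ε ≤ g t → g' t ≤ -c) : ∀ t < T, g t ≤ ε := by
  intro t ht
  -- The barrier falls from `C` at time `a` to `ε` at time `t` with slope `-c/2`, strictly shallower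
  -- than the forced decrease `-c`, as the comparison at contact points requires.
  set a := t - 2 * (C - ε) / c with ha
  have hat : a ≤ t := by
    have : 0 ≤ 2 * (C - ε) / c := div_nonneg (by linarith) hc.le
    linarith
  have hB : C - c / 2 * (t - a) = ε := by
    rw [ha]
    field_simp
    ring
  have key := image_le_of_deriv_right_lt_deriv_boundary (f := g) (f' := g') (a := a) (b := t)
    (B := fun τ => C - c / 2 * (τ - a)) (B' := fun _ => -(c / 2))
    (fun τ hτ => (hg τ (by linarith [hτ.2])).continuousAt.continuousWithinAt)
    (fun τ hτ => (hg τ (by linarith [hτ.2])).hasDerivWithinAt)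
    (by simpa using hC a (by linarith))
    (fun τ => by simpa using (((hasDerivAt_id τ).sub_const a).const_mul (c / 2)).const_sub C)
    (fun τ hτ h => by
      have h1 : c / 2 * (τ - a) ≤ c / 2 * (t - a) := by gcongr; exact hτ.2.le
      have := hdec τ (hτ.2.trans ht) (by rw [h]; linarith)
      linarith)
    ⟨hat, le_rfl⟩
  simpa [hB] using key

end Trapping

/-! ### The ancient trajectory and its asymptotics -/

section Ancient

variable {f f₀ : ℝ → ℝ} {n q : ℝ}

theorem exists_time_exp_lt {A : ℝ} (hA : 0 < A) (T₀ : ℝ) :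
    ∃ T ≤ T₀, Real.exp (2 * T + 1) < A := by
  refine ⟨min T₀ ((Real.log A - 2) / 2), min_le_left _ _, ?_⟩
  rw [← Real.lt_log_iff_exp_lt hA]
  linarith [min_le_right T₀ ((Real.log A - 2) / 2)]

theorem exists_ancient_trajectory (hf : ContDiffOn ℝ 1 f (Ici 0))
    (hg : ContDiffOn ℝ 1 f₀ (Ici 0)) (hpos : ∀ u, 0 < u → 0 < f₀ u) (hfin : TailFinite f₀)
    (hlimq : Tendsto (fun u => deriv f₀ u * tailIntegral f₀ u) atTop (𝓝 q))
    (hratio : Tendsto (fun u => f u / f₀ u) atTop (𝓝 1))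
    (ha : 0 < n + 2 - 4 * q) (hZ : 0 < 2 * n - 4 * q) :
    ∃ (t₀ : ℝ) (x : ℝ → ℝ × ℝ),
      (∀ t < t₀, HasDerivAt x (emdenField n f t (x t)) t ∧ 0 < (x t).1) ∧
      Tendsto (fun t => logDev f₀ (2 * n - 4 * q) t (x t).1) atBot (𝓝 0) := by
  obtain ⟨κ, ε₀, hε₀, hκ, hsmall, hlyap⟩ := exists_lyapunov ha hZ
  generalize 2 * n - 4 * q = Z at *
  have hclose : ∀ δ : ℝ, 0 < δ → ∃ m : ℝ, 0 < m ∧ ∀ U, m ≤ U →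
      |f U / f₀ U - 1| ≤ δ ∧ |deriv f₀ U * tailIntegral f₀ U - q| ≤ δ := by
    intro δ hδ
    have h1 := (Metric.tendsto_nhds.1 hratio) δ hδ
    have h2 := (Metric.tendsto_nhds.1 hlimq) δ hδ
    obtain ⟨m, hm⟩ := eventually_atTop.1 (h1.and h2)
    refine ⟨max m 1, by positivity, fun U hU => ?_⟩
    obtain ⟨h3, h4⟩ := hm U ((le_max_left _ _).trans hU)
    exact ⟨h3.le, h4.le⟩
  obtain ⟨δ, c, hδ, hc, hdec⟩ := hlyap ε₀ hε₀
  obtain ⟨m, hm, hmδ⟩ := hclose δ hδ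
  -- Before this `t₀`, the bound `|w| ≤ 1` forces `U > m`.
  obtain ⟨t₀, -, ht₀⟩ := exists_time_exp_lt (mul_pos hZ (tailIntegral_pos hg hpos hfin hm)) 0
  obtain ⟨x, hx⟩ := exists_ancient_solution (v := emdenField n f)
    (D := trap f₀ Z κ ε₀ m) (t₀ := t₀)
    (isClosed_trap hg hpos hfin hZ hm ε₀) (isCompact_trap hg hpos hfin hsmall hZ hm t₀)
    (fun s => by
      obtain ⟨M, B, -, -, -, hM⟩ := exists_trap_subset hg hpos hfin hsmall hZ hm s
      obtain ⟨K, hK⟩ := exists_lipschitz_emdenField hf (M := M) hm.le n t₀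
      exact ⟨K, fun t ht => (hK t ht.2).mono fun y hy => ⟨hy.1, (hM t ht.1 y hy).1.le⟩⟩)
    (fun k => exists_trapped_solution hf hg hpos hfin hZ hε₀ hsmall hm (by simp) ht₀
      fun U hU η w hE => (hdec η w _ _ hE.ge hE.le (hmδ U hU).1 (hmδ U hU).2).trans_lt
        (neg_neg_of_pos hc))
  have hxpos : ∀ t < t₀, 0 < (x t).1 := fun t ht => hm.trans_le (hx t ht).2.1
  refine ⟨t₀, x, fun t ht => ⟨(hx t ht).1, hxpos t ht⟩, ?_⟩
  have hEsmall : ∀ ε : ℝ, 0 < ε → ε ≤ ε₀ → ∃ T ≤ t₀, ∀ t < T, stateEnergy f₀ Z κ t (x t) ≤ ε := by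
    intro ε hε hεε₀
    obtain ⟨δ', c', hδ', hc', hdec'⟩ := hlyap ε hε
    obtain ⟨m', hm', hmδ'⟩ := hclose δ' hδ'
    obtain ⟨T, hT, hTm⟩ :=
      exists_time_exp_lt (mul_pos hZ (tailIntegral_pos hg hpos hfin hm')) t₀
    refine ⟨T, hT, eventually_le_of_deriv_le (C := ε₀)
      (fun t ht => hasDerivWithinAt_univ.1
        (hasDerivWithinAt_stateEnergy hg hpos hfin hZ (hx t ht).1.hasDerivWithinAt (hxpos t ht)))
      (fun t ht => (hx t ht).2.2) hT hc' hεε₀ fun t ht hE => ?_⟩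
    have ht' := ht.trans_le hT
    have hU : m' < (x t).1 := lt_of_abs_logDev_le hg hpos hfin hZ (hxpos t ht')
      (hsmall _ _ (hx t ht').2.2).2 ht.le hm' hTm
    exact hdec' _ _ _ _ hE (hx t ht').2.2 (hmδ' _ hU.le).1 (hmδ' _ hU.le).2
  rw [Metric.tendsto_nhds]
  intro ε hε
  -- As the energy is at least `Z w² / 4`, the level `Z ε² / 8` gives `w² ≤ ε² / 2 < ε²`.
  obtain ⟨T, hT, hTE⟩ := hEsmall (min ε₀ (Z * ε ^ 2 / 8)) (by positivity) (min_le_left _ _)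
  filter_upwards [eventually_lt_atBot T] with t ht
  have h1 := (hTE t ht).trans (min_le_right _ _)
  have h2 := energy_lower (η := slopeDev f₀ (x t).1 (x t).2) (w := logDev f₀ Z t (x t).1) hκ
  rw [dist_zero_right, Real.norm_eq_abs]
  refine abs_lt_of_sq_lt_sq ?_ hε.le
  refine lt_of_mul_lt_mul_left ?_ hZ.le
  unfold stateEnergy at h1
  nlinarith [sq_nonneg (slopeDev f₀ (x t).1 (x t).2), mul_pos hZ (pow_pos hε 2)]

end Ancient

/-! ### Return to the radial variable -/

section Radial

variable {N : ℕ} {f f₀ : ℝ → ℝ} {t₀ : ℝ} {x : ℝ → ℝ × ℝ}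

theorem log_lt_of_mem_Ioo {r : ℝ} (hr : r ∈ Ioo 0 (Real.exp t₀)) : Real.log r < t₀ :=
  (Real.log_lt_iff_lt_exp hr.1).2 hr.2

/-- Passing from the logarithmic variable back to the radial variable. -/
theorem isRadialSolution_of_trajectory (hf : ContDiffOn ℝ 1 f (Ici 0))
    (hx : ∀ t < t₀, HasDerivAt x (emdenField N f t (x t)) t) (hpos : ∀ t < t₀, 0 < (x t).1) :
    IsRadialSolution N f (Real.exp t₀) (fun r => (x (Real.log r)).1) := by
  set S : Set ℝ := Ioo 0 (Real.exp t₀)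
  have hS : IsOpen S := isOpen_Ioo
  have hxlog : ∀ r ∈ S, HasDerivAt (fun r => x (Real.log r))
      (r⁻¹ • emdenField N f (Real.log r) (x (Real.log r))) r := fun r hr =>
    (hx _ (log_lt_of_mem_Ioo hr)).scomp r (Real.hasDerivAt_log hr.1.ne')
  have h1 : ∀ r ∈ S, HasDerivAt (fun r => (x (Real.log r)).1) (r⁻¹ * (x (Real.log r)).2) r :=
    fun r hr => (hxlog r hr).fst
  have h2 : ∀ r ∈ S, HasDerivAt (fun r => r⁻¹ * (x (Real.log r)).2)
      (-(r ^ 2)⁻¹ * (x (Real.log r)).2 + r⁻¹ * (r⁻¹ * (-((N : ℝ) - 2) * (x (Real.log r)).2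
        - Real.exp (2 * Real.log r) * f (x (Real.log r)).1))) r := fun r hr =>
    (hasDerivAt_inv hr.1.ne').mul (hxlog r hr).snd
  have hd1 : ∀ r ∈ S, deriv (fun r => (x (Real.log r)).1) r = r⁻¹ * (x (Real.log r)).2 :=
    fun r hr => (h1 r hr).deriv
  have hd2 : ∀ r ∈ S, HasDerivAt (deriv (fun r => (x (Real.log r)).1))
      (-(r ^ 2)⁻¹ * (x (Real.log r)).2 + r⁻¹ * (r⁻¹ * (-((N : ℝ) - 2) * (x (Real.log r)).2
        - Real.exp (2 * Real.log r) * f (x (Real.log r)).1))) r := fun r hr =>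
    (h2 r hr).congr_of_eventuallyEq (eventually_of_mem (hS.mem_nhds hr) hd1)
  refine ⟨?_, fun r hr => hpos _ (log_lt_of_mem_Ioo hr), fun r hr => ?_⟩
  · rw [show (2 : WithTop ℕ∞) = 1 + 1 from by norm_num, contDiffOn_succ_iff_deriv_of_isOpen hS]
    refine ⟨fun r hr => (h1 r hr).differentiableAt.differentiableWithinAt, by simp, ?_⟩
    rw [show (1 : WithTop ℕ∞) = 0 + 1 from by norm_num, contDiffOn_succ_iff_deriv_of_isOpen hS]
    refine ⟨fun r hr => (hd2 r hr).differentiableAt.differentiableWithinAt, by simp, ?_⟩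
    rw [contDiffOn_zero]
    refine ContinuousOn.congr ?_ fun r hr => (hd2 r hr).deriv
    have hne : ∀ r ∈ S, r ≠ 0 := fun r hr => hr.1.ne'
    have hxc : ContinuousOn (fun r => x (Real.log r)) S := fun r hr =>
      (hxlog r hr).continuousAt.continuousWithinAt
    have hinv : ContinuousOn (fun r : ℝ => r⁻¹) S := continuousOn_id.inv₀ hne
    have hlog : ContinuousOn Real.log S := Real.continuousOn_log.mono hne
    have hfc : ContinuousOn (fun r => f (x (Real.log r)).1) S :=
      hf.continuousOn.comp hxc.fst fun r hr => (hpos _ (log_lt_of_mem_Ioo hr)).le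
    have hinv2 : ContinuousOn (fun r : ℝ => (r ^ 2)⁻¹) S :=
      (continuousOn_id.pow 2).inv₀ fun r hr => pow_ne_zero 2 (hne r hr)
    exact (hinv2.neg.mul hxc.snd).add (hinv.mul (hinv.mul ((continuousOn_const.mul hxc.snd).sub
      ((Real.continuous_exp.comp_continuousOn (continuousOn_const.mul hlog)).mul hfc))))
  · have hr0 : r ≠ 0 := hr.1.ne'
    have hexp : Real.exp (2 * Real.log r) = r ^ 2 := by
      rw [two_mul, Real.exp_add, Real.exp_log hr.1, sq]
    rw [(hd2 r hr).deriv, hd1 r hr, hexp]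
    field_simp
    ring

theorem tendsto_atTop_of_tendsto_logDev (hg : ContDiffOn ℝ 1 f₀ (Ici 0))
    (hpos : ∀ u, 0 < u → 0 < f₀ u) (hfin : TailFinite f₀) {Z : ℝ} (hZ : 0 < Z)
    (hx : ∀ t < t₀, 0 < (x t).1)
    (hw : Tendsto (fun t => logDev f₀ Z t (x t).1) atBot (𝓝 0)) :
    Tendsto (fun t => (x t).1) atBot atTop := by
  rw [tendsto_atTop]
  intro M
  have hM : 0 < max M 1 := by positivity
  obtain ⟨T, hT, hTM⟩ := exists_time_exp_lt (mul_pos hZ (tailIntegral_pos hg hpos hfin hM)) t₀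
  have hw1 := (Metric.tendsto_nhds.1 hw) 1 one_pos
  filter_upwards [hw1, eventually_lt_atBot T] with t ht htT
  rw [dist_zero_right, Real.norm_eq_abs] at ht
  exact (le_max_left _ _).trans (lt_of_abs_logDev_le hg hpos hfin hZ
    (hx t (htT.trans_le hT)) ht.le htT.le hM hTM).le

end Radial

end RadialSingular

/-! ### The singular solution -/

theorem proposition3p1 (N : ℕ) (hN : 3 ≤ N) (f f₀ : ℝ → ℝ) (q : ℝ)
    (hf : RadialSingular.IsNonlinearTerm f)
    (hA2 : RadialSingular.AssumptionA2 f f₀ q)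
    (hq : q < RadialSingular.qS N) :
    ∃ r₀ : ℝ, 0 < r₀ ∧ ∃ U θ : ℝ → ℝ,
      RadialSingular.IsRadialSolution N f r₀ U ∧
      RadialSingular.SingularAtOrigin U ∧
      ContDiffOn ℝ 2 θ (Ioo 0 r₀) ∧
      Tendsto θ (𝓝[>] 0) (𝓝 0) ∧
      ∀ r ∈ Ioo 0 r₀,
        (2 * (N : ℝ) - 4 * q)⁻¹ * r ^ 2 * (1 + θ r) ∈
            RadialSingular.tailIntegral f₀ '' Ioi 0 ∧
          U r = RadialSingular.tailInverse f₀
            ((2 * (N : ℝ) - 4 * q)⁻¹ * r ^ 2 * (1 + θ r)) := by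
  open RadialSingular in
  obtain ⟨α, -, -, hf1, -⟩ := hf.regular
  obtain ⟨hg, hpos, hfin, hlimq, hratio⟩ := hA2
  have hN3 : (3 : ℝ) ≤ N := by exact_mod_cast hN
  rw [qS, if_neg (by omega)] at hq
  have ha : 0 < (N : ℝ) + 2 - 4 * q := by linarith
  have hZ : 0 < 2 * (N : ℝ) - 4 * q := by linarith
  obtain ⟨t₀, x, hx, hw⟩ := exists_ancient_trajectory hf1 hg hpos hfin hlimq hratio ha hZ
  generalize 2 * (N : ℝ) - 4 * q = Z at *
  have hxpos : ∀ t < t₀, 0 < (x t).1 := fun t ht => (hx t ht).2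
  have hsol := isRadialSolution_of_trajectory hf1 (fun t ht => (hx t ht).1) hxpos
  have hval : ∀ r ∈ Ioo 0 (Real.exp t₀), Z * tailIntegral f₀ (x (Real.log r)).1 / r ^ 2
      = Real.exp (-logDev f₀ Z (Real.log r) (x (Real.log r)).1) := by
    intro r hr
    have hr0 := hr.1.ne'
    rw [tailIntegral_eq_exp hg hpos hfin hZ (t := Real.log r) (hxpos _ (log_lt_of_mem_Ioo hr)),
      sub_eq_add_neg, Real.exp_add, two_mul, Real.exp_add, Real.exp_log hr.1]
    field_simp
  -- This `θ` makes the argument of the inverse equal to `F₀(U)` identically; by `hval` it is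
  -- `e^{-w} - 1`.
  refine ⟨Real.exp t₀, Real.exp_pos _, fun r => (x (Real.log r)).1,
    fun r => Z * tailIntegral f₀ (x (Real.log r)).1 / r ^ 2 - 1, hsol, ?_, ?_, ?_, ?_⟩
  · exact (tendsto_atTop_of_tendsto_logDev hg hpos hfin hZ hxpos hw).comp
      Real.tendsto_log_nhdsGT_zero
  · refine ContDiffOn.sub (ContDiffOn.div (contDiffOn_const.mul ?_) (contDiffOn_id.pow 2)
      fun r hr => pow_ne_zero 2 hr.1.ne') contDiffOn_const
    exact (contDiffOn_tailIntegral hg hpos hfin).comp hsol.contDiffOn fun r hr => hsol.pos r hr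
  · have h : Tendsto (fun r => Real.exp (-logDev f₀ Z (Real.log r) (x (Real.log r)).1) - 1)
        (𝓝[>] 0) (𝓝 0) := by
      have h1 := (hw.comp Real.tendsto_log_nhdsGT_zero).neg.rexp.sub_const 1
      simpa using h1
    refine h.congr' ?_
    filter_upwards [Ioo_mem_nhdsGT (Real.exp_pos t₀)] with r hr
    rw [hval r hr]
  · intro r hr
    have hr0 := hr.1.ne'
    have hU := hxpos _ (log_lt_of_mem_Ioo hr)
    have e : Z⁻¹ * r ^ 2 * (1 + (Z * tailIntegral f₀ (x (Real.log r)).1 / r ^ 2 - 1))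
        = tailIntegral f₀ (x (Real.log r)).1 := by
      have := hZ.ne'
      field_simp
      ring
    simp only [e]
    exact ⟨⟨_, hU, rfl⟩, (tailInverse_tailIntegral hg hpos hfin hU).symm⟩
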